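/- Let $m<n$ be natural numbers, let $A$ and $B$ be compact topological spaces, and let $f:A\to\mathbb{R}^n$ and $g:B\to\mathbb{R}^n$ be embeddings with $f(A)\cap g(B)=\emptyset$. Consider the map $$\xi_{fg}:A\times B\to S^{n-1},\qquad \xi_{fg}(x,y)=\frac{f(x)-g(y)}{\|f(x)-g(y)\|}.$$ Given a homomorphism $o:H_{n-1}(S^{n-1};\mathbb{Z})\to\mathbb{Z}$ and a singular homology class $\mu\in H_{n-1}(A\times B;\mathbb{Z})$, define the linking number of $f(A)$ and $g(B)$ with respect to $o$ and $\mu$ as the degree of $\xi_{fg}$, $$\operatorname{lk}(f(A),g(B))=o\big((\xi_{fg})_*\mu\big)\in\mathbb{Z}.$$ (If $n\ge 2$, $A$ and $B$ are closed oriented manifolds with $\dim A+\dim B=n-1$, $\mu$ is the fundamental class of $A\times B$, and $o$ is the isomorphism given by an orientation of $S^{n-1}$, this is the usual linking number.) Let $F:\mathbb{R}^n\to\mathbb{R}^m$ be a continuous map that is conjugate to a linear map $L:\mathbb{R}^n\to\mathbb{R}^m$, i.e. $F=\psi\circ L\circ\varphi$ for some homeomorphisms $\varphi:\mathbb{R}^n\to\mathbb{R}^n$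 and $\psi:\mathbb{R}^m\to\mathbb{R}^m$. If $\operatorname{lk}(f(A),g(B))\neq 0$ for some $o$ and $\mu$ as above, then $$F(f(A))\cap F(g(B))\neq\emptyset.$$ -/

import Mathlib

/-- Two maps `F G : ℝⁿ → ℝᵐ` are conjugate if `F = ψ ∘ G ∘ φ` for homeomorphisms
`φ : ℝⁿ → ℝⁿ` and `ψ : ℝᵐ → ℝᵐ`. -/
def AreConjugate {n m : ℕ} (F G : EuclideanSpace ℝ (Fin n) → EuclideanSpace ℝ (Fin m)) : Prop :=
  ∃ (φ : EuclideanSpace ℝ (Fin n) ≃ₜ EuclideanSpace ℝ (Fin n))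
    (ψ : EuclideanSpace ℝ (Fin m) ≃ₜ EuclideanSpace ℝ (Fin m)), F = ψ ∘ G ∘ φ

/-- The map `ξ : A × B → Sⁿ⁻¹`, `ξ (x, y) = (f x - g y) / ‖f x - g y‖`, of two continuous maps
`f : A → ℝⁿ` and `g : B → ℝⁿ` with disjoint images. -/
noncomputable def gaussLinkMap {n : ℕ} {A B : Type} [TopologicalSpace A] [TopologicalSpace B]
    (f : C(A, EuclideanSpace ℝ (Fin n))) (g : C(B, EuclideanSpace ℝ (Fin n)))
    (hfg : Disjoint (Set.range f) (Set.range g)) :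
    C(A × B, Metric.sphere (0 : EuclideanSpace ℝ (Fin n)) 1) :=
  have hne : ∀ p : A × B, ‖f p.1 - g p.2‖ ≠ 0 := fun p h =>
    Set.disjoint_left.1 hfg (Set.mem_range_self p.1)
      ⟨p.2, (sub_eq_zero.1 (norm_eq_zero.1 h)).symm⟩
  { toFun := fun p => ⟨‖f p.1 - g p.2‖⁻¹ • (f p.1 - g p.2), by
      rw [mem_sphere_zero_iff_norm, norm_smul, norm_inv, norm_norm, inv_mul_cancel₀ (hne p)]⟩
    continuous_toFun := by
      have hc : Continuous fun p : A × B => f p.1 - g p.2 := by fun_prop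
      exact ((hc.norm.inv₀ hne).smul hc).subtype_mk _ }

/-- Singular homology `H_k(X; ℤ)`. -/
noncomputable abbrev singularH (k : ℕ) (X : Type) [TopologicalSpace X] : ModuleCat.{0} ℤ :=
  ((AlgebraicTopology.singularHomologyFunctor (ModuleCat.{0} ℤ) k).obj (ModuleCat.of ℤ ℤ)).obj
    (TopCat.of X)

/-- The homomorphism `H_k(X; ℤ) → H_k(Y; ℤ)` induced by a continuous map `X → Y`. -/
noncomputable def singularHMap (k : ℕ) {X Y : Type} [TopologicalSpace X] [TopologicalSpace Y]
    (h : C(X, Y)) : singularH k X →ₗ[ℤ] singularH k Y :=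
  (((AlgebraicTopology.singularHomologyFunctor (ModuleCat.{0} ℤ) k).obj (ModuleCat.of ℤ ℤ)).map
    (TopCat.ofHom h)).hom

/-- The degree of a map `h : X → Sⁿ⁻¹` on a class `μ ∈ H_{n-1}(X; ℤ)`: the integer `o (h_* μ)`.
If `X` is a closed oriented `(n-1)`-manifold, `μ` is its fundamental class and
`o : H_{n-1}(Sⁿ⁻¹; ℤ) → ℤ` is the isomorphism given by an orientation of the sphere (`n ≥ 2`),
this is the usual topological degree. -/
noncomputable def sphereDegree {n : ℕ} {X : Type} [TopologicalSpace X]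
    (o : singularH (n - 1) (Metric.sphere (0 : EuclideanSpace ℝ (Fin n)) 1) →ₗ[ℤ] ℤ)
    (μ : singularH (n - 1) X)
    (h : C(X, Metric.sphere (0 : EuclideanSpace ℝ (Fin n)) 1)) : ℤ :=
  o (singularHMap (n - 1) h μ)

/-- The linking number of `f : A → ℝⁿ` and `g : B → ℝⁿ`: the degree of the map
`(x, y) ↦ (f x - g y) / ‖f x - g y‖` on a class `μ ∈ H_{n-1}(A × B; ℤ)`. For closed oriented
manifolds `A`, `B` with `dim A + dim B = n - 1`, `μ` is the fundamental class of `A × B`. -/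
noncomputable def linkingNumber {n : ℕ} {A B : Type} [TopologicalSpace A] [TopologicalSpace B]
    (o : singularH (n - 1) (Metric.sphere (0 : EuclideanSpace ℝ (Fin n)) 1) →ₗ[ℤ] ℤ)
    (μ : singularH (n - 1) (A × B))
    (f : C(A, EuclideanSpace ℝ (Fin n))) (g : C(B, EuclideanSpace ℝ (Fin n)))
    (hfg : Disjoint (Set.range f) (Set.range g)) : ℤ :=
  sphereDegree o μ (gaussLinkMap f g hfg)

open CategoryTheory CategoryTheory.Limits AlgebraicTopology

/-! Suppose the images under `F` are disjoint. Then `L` separates `φ ∘ f` from `φ ∘ g`, and `m < n`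
gives a nonzero `v` in the kernel of `L`. Shrinking `φ ∘ f` linearly to `v` and `φ ∘ g` to `0` never
makes them meet, so the Gauss map is nullhomotopic and kills homology in positive degree. Only `n =
1` needs a separate argument. -/

theorem singularHMap_comp (k : ℕ) {X Y Z : Type} [TopologicalSpace X] [TopologicalSpace Y]
    [TopologicalSpace Z] (g : C(Y, Z)) (f : C(X, Y)) (c : singularH k X) :
    singularHMap k (g.comp f) c = singularHMap k g (singularHMap k f c) := by
  unfold singularHMap
  rw [TopCat.ofHom_comp, Functor.map_comp]
  rfl

theorem singularHMap_eq_of_homotopic (k : ℕ) {X Y : Type} [TopologicalSpace X]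
    [TopologicalSpace Y] {f g : C(X, Y)} (h : f.Homotopic g) :
    singularHMap k f = singularHMap k g := by
  obtain ⟨H⟩ := h
  exact congrArg ModuleCat.Hom.hom (TopCat.Homotopy.congr_homologyMap_singularChainComplexFunctor
    (f := TopCat.ofHom f) (g := TopCat.ofHom g) H (ModuleCat.of ℤ ℤ) k)

/-- Singular homology of a totally disconnected space vanishes in positive degrees. -/
theorem subsingleton_singularH_of_totallyDisconnectedSpace {k : ℕ} (hk : k ≠ 0) (X : Type)
    [TopologicalSpace X] [TotallyDisconnectedSpace X] : Subsingleton (singularH k X) := by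
  have : TotallyDisconnectedSpace (TopCat.of X) := ‹_›
  exact ModuleCat.subsingleton_of_isZero
    (isZero_singularHomologyFunctor_of_totallyDisconnectedSpace (ModuleCat.{0} ℤ) k
      (ModuleCat.of ℤ ℤ) (TopCat.of X) hk)

theorem subsingleton_singularH_zero_of_isEmpty (X : Type) [TopologicalSpace X] [IsEmpty X] :
    Subsingleton (singularH 0 X) := by
  have : IsEmpty (TopCat.of X) := ‹_›
  have : TotallyDisconnectedSpace (TopCat.of X) := inferInstance
  refine ModuleCat.subsingleton_of_isZero (IsZero.of_iso ?_
    (singularHomologyFunctorZeroOfTotallyDisconnectedSpace (ModuleCat.{0} ℤ)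
      (ModuleCat.of ℤ ℤ) (TopCat.of X)))
  -- `H_0` is a coproduct indexed by the points, here an empty one.
  refine (IsZero.iff_id_eq_zero _).2 (Sigma.hom_ext _ _ fun x => isEmptyElim x)

/-- A constant map factors through a point, which has no homology in positive degree. -/
theorem singularHMap_apply_eq_zero_of_nullhomotopic {k : ℕ} (hk : k ≠ 0) {X Y : Type}
    [TopologicalSpace X] [TopologicalSpace Y] {f : C(X, Y)} (h : f.Nullhomotopic)
    (c : singularH k X) : singularHMap k f c = 0 := by
  obtain ⟨y, hy⟩ := h
  have hfac : ContinuousMap.const X y =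
      (ContinuousMap.const PUnit.{1} y).comp (ContinuousMap.const X PUnit.unit) := rfl
  have := subsingleton_singularH_of_totallyDisconnectedSpace hk PUnit.{1}
  rw [singularHMap_eq_of_homotopic k hy, hfac, singularHMap_comp,
    Subsingleton.elim (singularHMap k (ContinuousMap.const X PUnit.unit) c) 0, map_zero]

/-- If after a change of coordinates `φ` of `ℝⁿ` the images of `f` and `g` are separated by a
linear map with nontrivial kernel, then the Gauss map of `f` and `g` is nullhomotopic: in the new
coordinates, contract `f` to a nonzero vector of the kernel and `g` to the origin. -/
theorem gaussLinkMap_nullhomotopic {n m : ℕ} {A B : Type} [TopologicalSpace A]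
    [TopologicalSpace B] (f : C(A, EuclideanSpace ℝ (Fin n))) (g : C(B, EuclideanSpace ℝ (Fin n)))
    (hfg : Disjoint (Set.range f) (Set.range g))
    (φ : EuclideanSpace ℝ (Fin n) ≃ₜ EuclideanSpace ℝ (Fin n))
    (L : EuclideanSpace ℝ (Fin n) →ₗ[ℝ] EuclideanSpace ℝ (Fin m))
    (hL : ∀ x y, L (φ (f x)) ≠ L (φ (g y)))
    {v : EuclideanSpace ℝ (Fin n)} (hv : v ≠ 0) (hLv : L v = 0) :
    (gaussLinkMap f g hfg).Nullhomotopic := by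
  let d : unitInterval × (A × B) → EuclideanSpace ℝ (Fin n) := fun p =>
    φ.symm ((1 - (p.1 : ℝ)) • φ (f p.2.1) + (p.1 : ℝ) • v) -
      φ.symm ((1 - (p.1 : ℝ)) • φ (g p.2.2))
  have hd : ∀ p, ‖d p‖ ≠ 0 := by
    rintro ⟨t, x, y⟩ h
    have h' := φ.symm.injective (sub_eq_zero.1 (norm_eq_zero.1 h))
    -- `L` kills the `v` term, so a collision at time `t` forces `t = 1`, where the two points are
    -- `v` and `0`.
    have hL' : (1 - (t : ℝ)) • (L (φ (f x)) - L (φ (g y))) = 0 := by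
      have := congrArg L h'
      simp only [map_add, map_smul, hLv, smul_zero, add_zero] at this
      rw [smul_sub, this, sub_self]
    rcases smul_eq_zero.1 hL' with ht | ht
    · have ht' : (t : ℝ) = 1 := by linarith
      simp only [ht', sub_self, zero_smul, one_smul, zero_add] at h'
      exact hv h'
    · exact hL x y (sub_eq_zero.1 ht)
  have hdc : Continuous d := by fun_prop
  let H : C(unitInterval × (A × B), Metric.sphere (0 : EuclideanSpace ℝ (Fin n)) 1) :=
    { toFun := fun p => ⟨‖d p‖⁻¹ • d p, by
        rw [mem_sphere_zero_iff_norm, norm_smul, norm_inv, norm_norm, inv_mul_cancel₀ (hd p)]⟩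
      continuous_toFun := by
        have hc : Continuous fun p => ‖d p‖⁻¹ • d p := (hdc.norm.inv₀ hd).smul hdc
        exact hc.subtype_mk _ }
  have hne : ‖φ.symm v - φ.symm 0‖ ≠ 0 := fun h =>
    hv (φ.symm.injective (sub_eq_zero.1 (norm_eq_zero.1 h)))
  refine ⟨⟨‖φ.symm v - φ.symm 0‖⁻¹ • (φ.symm v - φ.symm 0), by
    rw [mem_sphere_zero_iff_norm, norm_smul, norm_inv, norm_norm, inv_mul_cancel₀ hne]⟩,
    ⟨{ toContinuousMap := H, map_zero_left := fun p => ?_, map_one_left := fun p => ?_ }⟩⟩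
  · apply Subtype.ext
    simp [H, d, gaussLinkMap]
  · apply Subtype.ext
    simp [H, d]

theorem theorem4p3 {m n : ℕ} (hmn : m < n)
    {A B : Type} [TopologicalSpace A] [CompactSpace A] [TopologicalSpace B] [CompactSpace B]
    (f : C(A, EuclideanSpace ℝ (Fin n))) (hf : Topology.IsEmbedding f)
    (g : C(B, EuclideanSpace ℝ (Fin n))) (hg : Topology.IsEmbedding g)
    (hfg : Disjoint (Set.range f) (Set.range g))
    (F : EuclideanSpace ℝ (Fin n) → EuclideanSpace ℝ (Fin m)) (hF : Continuous F)
    (L : EuclideanSpace ℝ (Fin n) →ₗ[ℝ] EuclideanSpace ℝ (Fin m)) (hFL : AreConjugate F L)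
    (o : singularH (n - 1) (Metric.sphere (0 : EuclideanSpace ℝ (Fin n)) 1) →ₗ[ℤ] ℤ)
    (μ : singularH (n - 1) (A × B))
    (hlink : linkingNumber o μ f g hfg ≠ 0) :
    (F '' Set.range f ∩ F '' Set.range g).Nonempty := by
  obtain ⟨φ, ψ, rfl⟩ := hFL
  by_contra hemp
  have hL : ∀ x y, L (φ (f x)) ≠ L (φ (g y)) := fun x y h =>
    hemp ⟨ψ (L (φ (f x))), ⟨f x, ⟨x, rfl⟩, rfl⟩, ⟨g y, ⟨y, rfl⟩, congrArg ψ h.symm⟩⟩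
  apply hlink
  suffices h : singularHMap (n - 1) (gaussLinkMap f g hfg) μ = 0 by
    rw [linkingNumber, sphereDegree, h, map_zero]
  by_cases hn : n - 1 = 0
  -- Here `n = 1`, and nullhomotopic maps need not vanish on `H_0`. But `ℝ⁰` is a point, so `L` can
  -- separate the images only if `A` or `B` is empty.
  · obtain rfl : m = 0 := by omega
    have : IsEmpty (A × B) := ⟨fun p => hL p.1 p.2 (Subsingleton.elim _ _)⟩
    have : Subsingleton (singularH (n - 1) (A × B)) :=
      hn ▸ subsingleton_singularH_zero_of_isEmpty (A × B)
    rw [Subsingleton.elim μ 0, map_zero]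
  · obtain ⟨v, hv, hv0⟩ := L.ker.exists_mem_ne_zero_of_ne_bot
      (LinearMap.ker_ne_bot_of_finrank_lt (by simpa using hmn))
    exact singularHMap_apply_eq_zero_of_nullhomotopic hn
      (gaussLinkMap_nullhomotopic f g hfg φ L hL hv0 hv) μ
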